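/- Let $m,n\ge 1$ and consider the linear program $$R_n^*=\max\Big\{\sum_{j=1}^n r_jx_j:\ \sum_{j=1}^n \bm a_j x_j\le \bm b,\ 0\le x_j\le 1\ (j=1,\dots,n)\Big\},\qquad r_j\in\mathbb R,\ \bm a_j\in\mathbb R^m,\ \bm b=n\bm d,\ \bm d\in\mathbb R^m.$$ Assume that $|r_j|\le\bar r$ and $\|\bm a_j\|_\infty\le\bar a$ for all $j$, that $0<\underline d\le d_i\le\bar d$ for all $i$, and that the data are in general position: for every price vector $\bm p\ge\bm 0$ at most $m$ columns $j$ satisfy $\bm a_j^\top\bm p=r_j$. The pairs $(r_j,\bm a_j)$ arrive in a uniformly random order $\sigma$ (pair $\sigma(t)$ arrives at time $t$). At each time $t=1,\dots,n$ the primal-beats-dual algorithm takes an optimal solution $\tilde{\bm x}^{(t)}$ of the scaled LP on the set $S_t=\{\sigma(1),\dots,\sigma(t)\}$ of columns revealed so far, $$\max\ \sum_{j\in S_t}r_jx_j\quad\text{s.t.}\quad \sum_{j\in S_t}a_{ij}x_j\le t\,d_i\ (i=1,\dots,m),\qquad 0\le x_j\le 1\ (j\in S_t),$$ where, if there are several optimal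 solutions, the choice depends only on the set $S_t$ and not on the order in which its elements arrived; then, with fresh independent randomness, it sets $x_t=1$ with probability $\tilde x^{(t)}_{\sigma(t)}$ and $x_t=0$ otherwise. Let $R_n=\sum_{t=1}^n r_{\sigma(t)}x_t$ be the objective value and $v(\bm x)=\big\|\big(\sum_{t=1}^n\bm a_{\sigma(t)}x_t-\bm b\big)^+\big\|_2$ the constraint violation of the output. Then there is a constant $C>0$ depending only on $\bar r,\bar a,\underline d,\bar d$ such that, for all $m,n\ge1$, all such data and all such choices of optimal solutions, $$R_n^*-\mathbb E[R_n]\le C\sqrt{mn},$$ and, if $n\ge 2$, $$\mathbb E[v(\bm x)]\le C\sqrt{mn}\,\log n,$$ where the expectations are over the random order and the random rounding. -/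

import Mathlib

/-- The data of an online linear program with `m` resource constraints and `n` columns:
rewards `r j`, columns `a j` (so `a j i` is the entry in row `i`), and the vector `d` of
per-period resource levels; the right-hand side is `b = n d`. -/
structure OnlineLP (m n : ℕ) where
  r : Fin n → ℝ
  a : Fin n → Fin m → ℝ
  d : Fin m → ℝ

namespace OnlineLP

noncomputable section

variable {m n : ℕ}

/-- The right-hand side `b = n d`. -/
def rhs (P : OnlineLP m n) (i : Fin m) : ℝ := (n : ℝ) * P.d i

/-- Feasible set of the LP relaxation: `A x ≤ b`, `0 ≤ x ≤ 1`. -/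
def primalFeasible (P : OnlineLP m n) : Set (Fin n → ℝ) :=
  {x | (∀ j, 0 ≤ x j ∧ x j ≤ 1) ∧ ∀ i, ∑ j, P.a j i * x j ≤ P.rhs i}

/-- `R_n^*`, the optimal value of the LP relaxation. -/
def primalValue (P : OnlineLP m n) : ℝ :=
  sSup ((fun x : Fin n → ℝ => ∑ j, P.r j * x j) '' P.primalFeasible)

/-- Boundedness: `|r_j| ≤ rbar`, `‖a_j‖_∞ ≤ abar`, `dlow ≤ d_i ≤ dbar`. -/
structure Bounded (P : OnlineLP m n) (rbar abar dlow dbar : ℝ) : Prop where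
  reward : ∀ j, |P.r j| ≤ rbar
  column : ∀ j i, |P.a j i| ≤ abar
  d_lower : ∀ i, dlow ≤ P.d i
  d_upper : ∀ i, P.d i ≤ dbar

/-- General position: for any price vector `p ≥ 0`, at most `m` columns satisfy `a_jᵀ p = r_j`. -/
def GeneralPosition (P : OnlineLP m n) : Prop :=
  ∀ p : Fin m → ℝ, (∀ i, 0 ≤ p i) → {j : Fin n | ∑ i, P.a j i * p i = P.r j}.ncard ≤ m

/-- Feasibility for the scaled LP on a set `S` of columns: `0 ≤ x_j ≤ 1` for `j ∈ S` and
`∑_{j ∈ S} a_{ij} x_j ≤ |S| d_i` for all `i`. Coordinates outside `S` play no role. -/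
def ScaledFeasible (P : OnlineLP m n) (S : Finset (Fin n)) (x : Fin n → ℝ) : Prop :=
  (∀ j ∈ S, 0 ≤ x j ∧ x j ≤ 1) ∧ ∀ i, ∑ j ∈ S, P.a j i * x j ≤ (S.card : ℝ) * P.d i

/-- `x` is an optimal solution of the scaled LP on the columns in `S`. -/
def IsScaledOptimal (P : OnlineLP m n) (S : Finset (Fin n)) (x : Fin n → ℝ) : Prop :=
  P.ScaledFeasible S x ∧
    ∀ y, P.ScaledFeasible S y → ∑ j ∈ S, P.r j * y j ≤ ∑ j ∈ S, P.r j * x j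

/-- An LP solver for the scaled LPs: it returns an optimal solution for every set of columns.
What it returns is determined by the set of columns, not by the order in which they arrived. -/
def IsSolver (P : OnlineLP m n) (sol : Finset (Fin n) → Fin n → ℝ) : Prop :=
  ∀ S, P.IsScaledOptimal S (sol S)

/-- The columns revealed up to and including time `t` if column `σ s` arrives at time `s`. -/
def revealed (σ : Equiv.Perm (Fin n)) (t : Fin n) : Finset (Fin n) :=
  (Finset.Iic t).map σ.toEmbedding

/-- The entry of the scaled LP solution at time `t` that belongs to the column arriving at `t`. -/
def fraction (sol : Finset (Fin n) → Fin n → ℝ) (σ : Equiv.Perm (Fin n)) (t : Fin n) : ℝ :=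
  sol (revealed σ t) (σ t)

/-- The probability that the columns arrive in the order `σ` and that the primal-beats-dual
algorithm outputs the binary vector `x` (`x t` is the decision at time `t`): `σ` is a uniform
random permutation and, given `σ`, the decisions are rounded independently, the one at time `t`
being `1` with probability `fraction sol σ t` and `0` otherwise. -/
def runProb (sol : Finset (Fin n) → Fin n → ℝ) (σ : Equiv.Perm (Fin n)) (x : Fin n → Bool) : ℝ :=
  (Fintype.card (Equiv.Perm (Fin n)) : ℝ)⁻¹ *
    ∏ t, (if x t then fraction sol σ t else 1 - fraction sol σ t)

/-- Expectation over the random arrival order and the random rounding. -/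
def runExpect (sol : Finset (Fin n) → Fin n → ℝ)
    (f : Equiv.Perm (Fin n) → (Fin n → Bool) → ℝ) : ℝ :=
  ∑ σ : Equiv.Perm (Fin n), ∑ x : Fin n → Bool, runProb sol σ x * f σ x

/-- A binary decision as a real number. -/
def bit (c : Bool) : ℝ := if c then 1 else 0

/-- `R_n`, the objective value of the output `x` under the arrival order `σ`. -/
def reward (P : OnlineLP m n) (σ : Equiv.Perm (Fin n)) (x : Fin n → Bool) : ℝ :=
  ∑ t, P.r (σ t) * bit (x t)

/-- The constraint violation `‖(A x - b)⁺‖₂` of the output `x` under the arrival order `σ`. -/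
def violation (P : OnlineLP m n) (σ : Equiv.Perm (Fin n)) (x : Fin n → Bool) : ℝ :=
  ‖(WithLp.toLp 2 (fun i => max (∑ t, P.a (σ t) i * bit (x t) - P.rhs i) 0) :
    EuclideanSpace ℝ (Fin m))‖

end

end OnlineLP

namespace OnlineLP

noncomputable section

/-! The engine is backward exchangeability: given the set `S_t` and all arrivals after time `t`, the
column arriving at `t` is uniform on `S_t` (`permAvg_mul_revealed`). Since the solution depends on
`S_t` only, the reward earned at time `t` has conditional mean `1/t` times the scaled LP value on
`S_t`, and the use of resource `i` has conditional mean at most `d i`.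

Violation: run backward in time, the deviations of use from these conditional means are orthogonal,
and the rounding errors are independent. So the use of each resource has second moment `O(n)` about
a compensator that never exceeds `b i` (`runExpect_use_sq_le`). Summing over the `m` resources and
applying Jensen gives `O(√(mn))`, with no logarithm.

Reward: restrict any point `x` feasible for the full LP to `S_t`. Sampling without replacement makes
it overload the scaled constraints by `O(√(mt))` on average (`permAvg_prefix_sq_le`). As `d` is
bounded below, shrinking `x` restores feasibility at a proportional cost (`sum_le_optimal_add`).
Hence the mean reward at time `t` is at least the value of `x` over `n`, less `O(√(m/t))`, and these
losses sum to `O(√(mn))`. -/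

/-! ### Averages over permutations -/

/-- The average of `F` over a uniformly random permutation. -/
def permAvg {n : ℕ} (F : Equiv.Perm (Fin n) → ℝ) : ℝ :=
  (Fintype.card (Equiv.Perm (Fin n)) : ℝ)⁻¹ * ∑ σ, F σ

section PermAvg

variable {n : ℕ}

theorem permAvg_add (F G : Equiv.Perm (Fin n) → ℝ) :
    permAvg (fun σ => F σ + G σ) = permAvg F + permAvg G := by
  simp [permAvg, Finset.sum_add_distrib, mul_add]

theorem permAvg_sum {ι : Type*} (s : Finset ι) (F : ι → Equiv.Perm (Fin n) → ℝ) :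
    permAvg (fun σ => ∑ i ∈ s, F i σ) = ∑ i ∈ s, permAvg (F i) := by
  simp only [permAvg]
  rw [Finset.sum_comm, Finset.mul_sum]

theorem permAvg_const_mul (c : ℝ) (F : Equiv.Perm (Fin n) → ℝ) :
    permAvg (fun σ => c * F σ) = c * permAvg F := by
  simp only [permAvg, ← Finset.mul_sum]
  ring

theorem card_perm_pos : (0 : ℝ) < Fintype.card (Equiv.Perm (Fin n)) := by
  exact_mod_cast Fintype.card_pos

theorem permAvg_const (c : ℝ) : permAvg (fun _ : Equiv.Perm (Fin n) => c) = c := by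
  have h := (card_perm_pos (n := n)).ne'
  simp only [permAvg, Finset.sum_const, Finset.card_univ, nsmul_eq_mul]
  field_simp

theorem permAvg_mono {F G : Equiv.Perm (Fin n) → ℝ} (h : ∀ σ, F σ ≤ G σ) :
    permAvg F ≤ permAvg G :=
  mul_le_mul_of_nonneg_left (Finset.sum_le_sum fun σ _ => h σ)
    (inv_nonneg.2 card_perm_pos.le)

theorem permAvg_comp_mul_right (τ : Equiv.Perm (Fin n)) (F : Equiv.Perm (Fin n) → ℝ) :
    permAvg (fun σ => F (σ * τ)) = permAvg F := by
  simp only [permAvg]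
  congr 1
  exact Equiv.sum_comp (Equiv.mulRight τ) F

end PermAvg

/-- Jensen's inequality for the square, as a bound on a mean by a bound on the second moment. -/
theorem weighted_sum_le_of_sq_le {ι : Type*} [Fintype ι] {w f : ι → ℝ} {M : ℝ}
    (hw : ∀ i, 0 ≤ w i) (hw1 : ∑ i, w i = 1) (hM : 0 ≤ M)
    (h : ∑ i, w i * f i ^ 2 ≤ M ^ 2) : ∑ i, w i * f i ≤ M := by
  refine (abs_le_of_sq_le_sq' ?_ hM).2
  set e := ∑ i, w i * f i with he
  have h0 : 0 ≤ ∑ i, w i * (f i - e) ^ 2 :=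
    Finset.sum_nonneg fun i _ => mul_nonneg (hw i) (sq_nonneg _)
  have h1 : ∑ i, w i * (f i - e) ^ 2 = ∑ i, w i * f i ^ 2 - e ^ 2 := by
    have : ∀ i, w i * (f i - e) ^ 2 = w i * f i ^ 2 - 2 * e * (w i * f i) + e ^ 2 * w i :=
      fun i => by ring
    simp only [this, Finset.sum_add_distrib, Finset.sum_sub_distrib, ← Finset.mul_sum, hw1, ← he]
    ring
  linarith

theorem permAvg_le_of_sq_le {n : ℕ} {F : Equiv.Perm (Fin n) → ℝ} {M : ℝ} (hM : 0 ≤ M)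
    (h : permAvg (fun σ => F σ ^ 2) ≤ M ^ 2) : permAvg F ≤ M := by
  simp only [permAvg, Finset.mul_sum] at h ⊢
  refine weighted_sum_le_of_sq_le (fun _ => inv_nonneg.2 card_perm_pos.le) ?_ hM h
  have h := permAvg_const (n := n) 1
  rwa [permAvg, Finset.mul_sum, Finset.sum_congr rfl fun _ _ => mul_one _] at h

/-! ### Exchangeability of the arrival order -/

section Exchange

variable {n : ℕ}

theorem mem_revealed {σ : Equiv.Perm (Fin n)} {t j : Fin n} :
    j ∈ revealed σ t ↔ σ.symm j ≤ t := by
  simp only [revealed, Finset.mem_map, Finset.mem_Iic, Equiv.coe_toEmbedding]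
  constructor
  · rintro ⟨s, hs, rfl⟩
    simpa using hs
  · intro h
    exact ⟨σ.symm j, h, by simp⟩

theorem card_revealed (σ : Equiv.Perm (Fin n)) (t : Fin n) :
    ((revealed σ t).card : ℝ) = (t : ℝ) + 1 := by
  simp [revealed]

theorem sum_revealed (σ : Equiv.Perm (Fin n)) (t : Fin n) (f : Fin n → ℝ) :
    ∑ j ∈ revealed σ t, f j = ∑ s ∈ Finset.Iic t, f (σ s) := by
  simp [revealed]

/-- The symmetry behind exchangeability: permuting arrivals within a prefix does not change what the
prefix has revealed. -/
theorem revealed_mul_swap (σ : Equiv.Perm (Fin n)) {r t s : Fin n} (hr : r ≤ s) (ht : t ≤ s) :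
    revealed (σ * Equiv.swap r t) s = revealed σ s := by
  ext j
  rw [mem_revealed, mem_revealed]
  have : (σ * Equiv.swap r t).symm j = Equiv.swap r t (σ.symm j) := rfl
  rw [this, Equiv.swap_apply_def]
  split_ifs with h1 h2
  · simp [h1, hr, ht]
  · simp [h2, hr, ht]
  · rfl

/-- The column arriving at time `t` is uniform on the set of columns revealed so far, given what
arrives later. -/
theorem permAvg_mul_revealed (t : Fin n) (K : Equiv.Perm (Fin n) → ℝ)
    (hK : ∀ r ≤ t, ∀ σ, K (σ * Equiv.swap r t) = K σ) (F : Finset (Fin n) → Fin n → ℝ) :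
    permAvg (fun σ => K σ * F (revealed σ t) (σ t)) =
      permAvg (fun σ => K σ * (((t : ℝ) + 1)⁻¹ * ∑ j ∈ revealed σ t, F (revealed σ t) j)) := by
  -- Swapping times `r` and `t` preserves the uniform law, `K` and the revealed set, so every `r ≤
  -- t` gives the same average. Averaging over these `t + 1` times (times start at `0`) gives the
  -- claim.
  have key : ∀ r ∈ Finset.Iic t, permAvg (fun σ => K σ * F (revealed σ t) (σ r)) =
      permAvg (fun σ => K σ * F (revealed σ t) (σ t)) := by
    intro r hr
    have hr := Finset.mem_Iic.1 hr
    rw [← permAvg_comp_mul_right (Equiv.swap r t)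
      (fun σ => K σ * F (revealed σ t) (σ t))]
    congr 1
    funext σ
    rw [hK r hr, revealed_mul_swap σ hr le_rfl]
    simp
  have ht : (t : ℝ) + 1 ≠ 0 := by positivity
  have h2 : ∀ σ, K σ * (((t : ℝ) + 1)⁻¹ * ∑ j ∈ revealed σ t, F (revealed σ t) j) =
      ((t : ℝ) + 1)⁻¹ * ∑ r ∈ Finset.Iic t, K σ * F (revealed σ t) (σ r) := by
    intro σ
    rw [sum_revealed σ t (F (revealed σ t)), ← Finset.mul_sum]
    ring
  simp only [h2]
  rw [permAvg_const_mul, permAvg_sum, Finset.sum_congr rfl key]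
  simp only [Finset.sum_const, Fin.card_Iic, nsmul_eq_mul]
  push_cast
  field_simp

theorem permAvg_revealed (t : Fin n) (F : Finset (Fin n) → Fin n → ℝ) :
    permAvg (fun σ => F (revealed σ t) (σ t)) =
      permAvg (fun σ => ((t : ℝ) + 1)⁻¹ * ∑ j ∈ revealed σ t, F (revealed σ t) j) := by
  simpa only [one_mul] using permAvg_mul_revealed t (fun _ => 1) (fun _ _ _ => rfl) F

/-- Sums of pairwise uncorrelated, or negatively correlated, variables. -/
theorem permAvg_sum_sq_le {ι : Type*} [DecidableEq ι] (s : Finset ι)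
    (F : ι → Equiv.Perm (Fin n) → ℝ) {c : ℝ} (hc : ∀ i ∈ s, ∀ σ, F i σ ^ 2 ≤ c)
    (h : ∀ i ∈ s, ∀ j ∈ s, i ≠ j → permAvg (fun σ => F i σ * F j σ) ≤ 0) :
    permAvg (fun σ => (∑ i ∈ s, F i σ) ^ 2) ≤ s.card * c := by
  have h1 : permAvg (fun σ => (∑ i ∈ s, F i σ) ^ 2) =
      ∑ i ∈ s, ∑ j ∈ s, permAvg (fun σ => F i σ * F j σ) := by
    simp only [sq, Finset.sum_mul_sum, permAvg_sum]
  rw [h1, ← nsmul_eq_mul, ← Finset.sum_const]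
  refine Finset.sum_le_sum fun i hi => ?_
  rw [← Finset.add_sum_erase _ _ hi]
  have h2 : permAvg (fun σ => F i σ * F i σ) ≤ c := by
    rw [← permAvg_const (n := n) c]
    exact permAvg_mono fun σ => by simpa [sq] using hc i hi σ
  have h3 : ∑ j ∈ s.erase i, permAvg (fun σ => F i σ * F j σ) ≤ 0 :=
    Finset.sum_nonpos fun j hj =>
      h i hi j (Finset.mem_of_mem_erase hj) (Finset.ne_of_mem_erase hj).symm
  linarith

/-- Deviations of the arriving column from the mean over the revealed set are uncorrelated. -/
theorem permAvg_sum_centered_sq_le (U : Finset (Fin n) → Fin n → ℝ)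
    (hU : ∀ S, ∑ j ∈ S, U S j = 0) {c : ℝ} (hc : ∀ S, ∀ j ∈ S, U S j ^ 2 ≤ c) :
    permAvg (fun σ => (∑ t, U (revealed σ t) (σ t)) ^ 2) ≤ n * c := by
  have key : ∀ s t : Fin n, t < s →
      permAvg (fun σ => U (revealed σ s) (σ s) * U (revealed σ t) (σ t)) = 0 := by
    intro s t hts
    -- The later term, at time `s`, plays the role of `K`: it is unaffected by swaps of times up to
    -- `t`. The earlier term then averages to zero by `hU`.
    rw [permAvg_mul_revealed t (fun σ => U (revealed σ s) (σ s))]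
    · simp [hU, permAvg]
    · intro r hr σ
      rw [revealed_mul_swap σ (hr.trans hts.le) hts.le]
      simp [Equiv.swap_apply_of_ne_of_ne (hr.trans_lt hts).ne' hts.ne']
  have := permAvg_sum_sq_le Finset.univ (fun t σ => U (revealed σ t) (σ t)) (c := c)
    (fun t _ σ => hc _ _ (by simp [mem_revealed])) (by
      intro s _ t _ hst
      rcases lt_or_gt_of_ne hst with h | h
      · rw [← key t s h]
        exact permAvg_mono fun σ => (mul_comm _ _).le
      · exact (key s t h).le)
  simpa using this

/-- Sampling without replacement is negatively correlated. -/
theorem permAvg_mul_le_zero {u : Fin n → ℝ} (hu : ∑ j, u j = 0) {s t : Fin n} (hst : s ≠ t) :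
    permAvg (fun σ => u (σ s) * u (σ t)) ≤ 0 := by
  -- All covariances with time `s` agree by symmetry; together with the nonnegative variance they
  -- sum to zero, as `u` has total zero.
  have hsymm : ∀ t' ∈ Finset.univ.erase s, permAvg (fun σ => u (σ s) * u (σ t')) =
      permAvg (fun σ => u (σ s) * u (σ t)) := by
    intro t' ht'
    rw [← permAvg_comp_mul_right (Equiv.swap t' t) (fun σ => u (σ s) * u (σ t))]
    congr 1
    funext σ
    simp [Equiv.swap_apply_of_ne_of_ne (Finset.ne_of_mem_erase ht').symm hst]
  have hsum : ∑ t', permAvg (fun σ => u (σ s) * u (σ t')) = 0 := by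
    rw [← permAvg_sum]
    have : ∀ σ : Equiv.Perm (Fin n), ∑ t', u (σ s) * u (σ t') = 0 := fun σ => by
      rw [← Finset.mul_sum, Equiv.sum_comp σ u, hu, mul_zero]
    simp [this, permAvg]
  rw [← Finset.add_sum_erase _ _ (Finset.mem_univ s), Finset.sum_congr rfl hsymm,
    Finset.sum_const, nsmul_eq_mul] at hsum
  have hcard : (0 : ℝ) < ((Finset.univ.erase s).card : ℝ) := by
    exact_mod_cast Finset.card_pos.2 ⟨t, by simp [hst.symm]⟩
  have hsq : 0 ≤ permAvg (fun σ => u (σ s) * u (σ s)) := by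
    rw [← permAvg_const (n := n) 0]
    exact permAvg_mono fun σ => mul_self_nonneg _
  by_contra hpos
  push Not at hpos
  have := mul_pos hcard hpos
  linarith

/-- The difference is a sum of `t + 1` centered draws without replacement, each at most `2 * B` in
size; negative correlation leaves only the diagonal terms. -/
theorem permAvg_prefix_sq_le {c : Fin n → ℝ} {B : ℝ} (hc : ∀ j, |c j| ≤ B) (t : Fin n) :
    permAvg (fun σ => (∑ j ∈ revealed σ t, c j - ((t : ℝ) + 1) / n * ∑ j, c j) ^ 2) ≤
      ((t : ℝ) + 1) * (2 * B) ^ 2 := by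
  have hn : (0 : ℝ) < n := by exact_mod_cast t.pos
  have havg : |(n : ℝ)⁻¹ * ∑ j, c j| ≤ B := by
    rw [abs_mul, abs_of_pos (inv_pos.2 hn), inv_mul_le_iff₀ hn]
    refine (Finset.abs_sum_le_sum_abs _ _).trans ((Finset.sum_le_sum fun j _ => hc j).trans ?_)
    simp
  have hu : ∑ j, (c j - (n : ℝ)⁻¹ * ∑ j, c j) = 0 := by
    simp only [Finset.sum_sub_distrib, Finset.sum_const, Finset.card_univ, Fintype.card_fin,
      nsmul_eq_mul]
    field_simp
    ring
  have := permAvg_sum_sq_le (Finset.Iic t) (fun s σ => c (σ s) - (n : ℝ)⁻¹ * ∑ j, c j)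
    (c := (2 * B) ^ 2)
    (fun s _ σ => sq_le_sq' (by linarith [abs_le.1 (hc (σ s)), abs_le.1 havg])
      (by linarith [abs_le.1 (hc (σ s)), abs_le.1 havg]))
    (fun s _ s' _ hss' =>
      permAvg_mul_le_zero (u := fun j => c j - (n : ℝ)⁻¹ * ∑ j, c j) hu hss')
  simp only [Fin.card_Iic] at this
  push_cast at this
  convert this using 4 with σ
  rw [sum_revealed, Finset.sum_sub_distrib, Finset.sum_const, Fin.card_Iic, nsmul_eq_mul]
  push_cast
  ring

end Exchange

/-! ### Independent rounding -/

/-- The average of `g` over independent bits, the one at `t` being `1` with probability `q t`. -/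
def roundAvg {n : ℕ} (q : Fin n → ℝ) (g : (Fin n → Bool) → ℝ) : ℝ :=
  ∑ x : Fin n → Bool, (∏ t, (if x t then q t else 1 - q t)) * g x

section RoundAvg

variable {n : ℕ}

theorem runExpect_eq (sol : Finset (Fin n) → Fin n → ℝ)
    (f : Equiv.Perm (Fin n) → (Fin n → Bool) → ℝ) :
    runExpect sol f = permAvg (fun σ => roundAvg (fraction sol σ) (f σ)) := by
  simp only [runExpect, runProb, permAvg, roundAvg, Finset.mul_sum, mul_assoc]

theorem roundAvg_add (q : Fin n → ℝ) (f g : (Fin n → Bool) → ℝ) :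
    roundAvg q (fun x => f x + g x) = roundAvg q f + roundAvg q g := by
  simp [roundAvg, mul_add, Finset.sum_add_distrib]

theorem roundAvg_const_mul (q : Fin n → ℝ) (c : ℝ) (g : (Fin n → Bool) → ℝ) :
    roundAvg q (fun x => c * g x) = c * roundAvg q g := by
  simp only [roundAvg, Finset.mul_sum]
  exact Finset.sum_congr rfl fun x _ => by ring

theorem roundAvg_sum (q : Fin n → ℝ) {ι : Type*} (s : Finset ι) (g : ι → (Fin n → Bool) → ℝ) :
    roundAvg q (fun x => ∑ i ∈ s, g i x) = ∑ i ∈ s, roundAvg q (g i) := by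
  simp only [roundAvg, Finset.mul_sum]
  exact Finset.sum_comm

/-- Independence of the bits: the sum over all outcomes factors. Marginals and pair moments follow
by setting the remaining factors to `1`. -/
theorem roundAvg_prod (q : Fin n → ℝ) (g : Fin n → Bool → ℝ) :
    roundAvg q (fun x => ∏ t, g t (x t)) =
      ∏ t, (q t * g t true + (1 - q t) * g t false) := by
  have h := Finset.prod_univ_sum (fun _ : Fin n => (Finset.univ : Finset Bool))
    (fun t c => (if c then q t else 1 - q t) * g t c)
  simp only [Fintype.sum_bool, Fintype.piFinset_univ] at h
  simp only [roundAvg, ← Finset.prod_mul_distrib]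
  simpa using h.symm

theorem roundAvg_one (q : Fin n → ℝ) : roundAvg q (fun _ => 1) = 1 := by
  simpa using roundAvg_prod q (fun _ _ => 1)

theorem roundAvg_const (q : Fin n → ℝ) (c : ℝ) : roundAvg q (fun _ => c) = c := by
  simpa [roundAvg_one] using roundAvg_const_mul q c (fun _ => 1)

theorem roundAvg_single (q : Fin n → ℝ) (t : Fin n) (f : Bool → ℝ) :
    roundAvg q (fun x => f (x t)) = q t * f true + (1 - q t) * f false := by
  have h := roundAvg_prod q (fun s c => if s = t then f c else 1)
  simp only [Finset.prod_ite_eq', Finset.mem_univ, if_true] at h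
  rw [h, ← Finset.mul_prod_erase _ _ (Finset.mem_univ t), Finset.prod_eq_one]
  · simp
  · intro s hs
    simp [Finset.ne_of_mem_erase hs]

theorem roundAvg_mul_of_ne (q : Fin n → ℝ) {s t : Fin n} (hst : s ≠ t) (f g : Bool → ℝ) :
    roundAvg q (fun x => f (x s) * g (x t)) =
      (q s * f true + (1 - q s) * f false) * (q t * g true + (1 - q t) * g false) := by
  have h := roundAvg_prod q
    (fun i c => (if i = s then f c else 1) * (if i = t then g c else 1))
  simp only [Finset.prod_mul_distrib, Finset.prod_ite_eq', Finset.mem_univ, if_true] at h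
  rw [h, ← Finset.mul_prod_erase _ _ (Finset.mem_univ s), ← Finset.mul_prod_erase _ _
    (show t ∈ Finset.univ.erase s by simp [hst.symm]), Finset.prod_eq_one]
  · simp [hst, hst.symm]
  · intro i hi
    have h1 := Finset.ne_of_mem_erase hi
    have h2 := Finset.ne_of_mem_erase (Finset.mem_of_mem_erase hi)
    simp [h1, h2]

theorem roundAvg_bit (q : Fin n → ℝ) (t : Fin n) : roundAvg q (fun x => bit (x t)) = q t := by
  simpa [bit] using roundAvg_single q t bit

/-- Bias-variance decomposition of a rounded weighted sum. -/
theorem roundAvg_sum_sq_le {q : Fin n → ℝ} (hq : ∀ t, 0 ≤ q t ∧ q t ≤ 1) (c : Fin n → ℝ)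
    (e B : ℝ) (hc : ∀ t, |c t| ≤ B) :
    roundAvg q (fun x => (∑ t, c t * bit (x t) - e) ^ 2) ≤
      n * B ^ 2 + (∑ t, c t * q t - e) ^ 2 := by
  set b := ∑ t, c t * q t - e with hb
  -- Split the error into centered rounding noise and the bias `b`. The cross term averages to zero,
  -- and independence leaves only the diagonal of the double sum.
  have hexp : ∀ x : Fin n → Bool, (∑ t, c t * bit (x t) - e) ^ 2 =
      (∑ s, ∑ t, (c s * (bit (x s) - q s)) * (c t * (bit (x t) - q t))) +
        (2 * b * (∑ t, c t * (bit (x t) - q t)) + b ^ 2) := by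
    intro x
    rw [← Finset.sum_mul_sum]
    have : ∑ t, c t * bit (x t) - e = ∑ t, c t * (bit (x t) - q t) + b := by
      simp only [hb, mul_sub, Finset.sum_sub_distrib]
      ring
    rw [this]
    ring
  simp only [hexp]
  rw [roundAvg_add, roundAvg_add, roundAvg_const, roundAvg_const_mul, roundAvg_sum, roundAvg_sum]
  have hlin : ∀ t, roundAvg q (fun x => c t * (bit (x t) - q t)) = 0 := by
    intro t
    rw [roundAvg_single q t (fun y => c t * (bit y - q t))]
    simp [bit]
    ring
  simp only [hlin, Finset.sum_const_zero, mul_zero, zero_add]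
  gcongr
  have : ∀ s ∈ Finset.univ, roundAvg q
      (fun x => ∑ t, (c s * (bit (x s) - q s)) * (c t * (bit (x t) - q t))) ≤ B ^ 2 := by
    intro s _
    rw [roundAvg_sum, Finset.sum_eq_single s]
    · rw [roundAvg_single q s (fun y => (c s * (bit y - q s)) * (c s * (bit y - q s)))]
      have h1 : c s ^ 2 ≤ B ^ 2 := sq_le_sq' (abs_le.1 (hc s)).1 (abs_le.1 (hc s)).2
      obtain ⟨h2, h3⟩ := hq s
      have h4 : q s * (1 - q s) ≤ 1 := by nlinarith
      have h5 : 0 ≤ q s * (1 - q s) := mul_nonneg h2 (by linarith)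
      have h6 : q s * (c s * (bit true - q s) * (c s * (bit true - q s))) +
          (1 - q s) * (c s * (bit false - q s) * (c s * (bit false - q s))) =
          c s ^ 2 * (q s * (1 - q s)) := by
        simp [bit]
        ring
      rw [h6]
      nlinarith [sq_nonneg (c s)]
    · intro t _ hts
      rw [roundAvg_mul_of_ne q hts.symm (fun y => c s * (bit y - q s))
        (fun y => c t * (bit y - q t))]
      simp [bit]
      left
      ring
    · simp
  simpa using Finset.sum_le_sum this

end RoundAvg

/-! ### The performance of the algorithm -/

section Main

variable {m n : ℕ}

theorem fraction_mem {P : OnlineLP m n} {sol : Finset (Fin n) → Fin n → ℝ} (hsol : P.IsSolver sol)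
    (σ : Equiv.Perm (Fin n)) (t : Fin n) : 0 ≤ fraction sol σ t ∧ fraction sol σ t ≤ 1 :=
  (hsol (revealed σ t)).1.1 _ (by simp [mem_revealed])

theorem runProb_nonneg {P : OnlineLP m n} {sol : Finset (Fin n) → Fin n → ℝ}
    (hsol : P.IsSolver sol) (σ : Equiv.Perm (Fin n)) (x : Fin n → Bool) :
    0 ≤ runProb sol σ x := by
  refine mul_nonneg (inv_nonneg.2 card_perm_pos.le) (Finset.prod_nonneg fun t _ => ?_)
  have := fraction_mem hsol σ t
  split_ifs <;> linarith

theorem runExpect_le_of_sq_le {P : OnlineLP m n} {sol : Finset (Fin n) → Fin n → ℝ}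
    (hsol : P.IsSolver sol) {f : Equiv.Perm (Fin n) → (Fin n → Bool) → ℝ} {M : ℝ} (hM : 0 ≤ M)
    (h : runExpect sol (fun σ x => f σ x ^ 2) ≤ M ^ 2) : runExpect sol f ≤ M := by
  have h1 : runExpect sol (fun _ _ => 1) = 1 := by
    rw [runExpect_eq]
    simp only [roundAvg_const, permAvg_const]
  simp only [runExpect, mul_one] at h h1 ⊢
  have key := weighted_sum_le_of_sq_le (ι := Equiv.Perm (Fin n) × (Fin n → Bool))
    (w := fun z => runProb sol z.1 z.2) (f := fun z => f z.1 z.2) (M := M)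
    (fun z => runProb_nonneg hsol z.1 z.2)
  simp only [Fintype.sum_prod_type] at key
  exact key h1 hM h

theorem runExpect_mono {P : OnlineLP m n} {sol : Finset (Fin n) → Fin n → ℝ}
    (hsol : P.IsSolver sol) {f g : Equiv.Perm (Fin n) → (Fin n → Bool) → ℝ}
    (h : ∀ σ x, f σ x ≤ g σ x) : runExpect sol f ≤ runExpect sol g :=
  Finset.sum_le_sum fun σ _ => Finset.sum_le_sum fun x _ =>
    mul_le_mul_of_nonneg_left (h σ x) (runProb_nonneg hsol σ x)

/-! ### Constraint violation -/

/-- The mean consumption of resource `i` over the columns in `S`, under the solution for `S`. -/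
def meanUse (P : OnlineLP m n) (sol : Finset (Fin n) → Fin n → ℝ) (i : Fin m)
    (S : Finset (Fin n)) : ℝ :=
  (S.card : ℝ)⁻¹ * ∑ j ∈ S, P.a j i * sol S j

theorem meanUse_le {P : OnlineLP m n} {sol : Finset (Fin n) → Fin n → ℝ} (hsol : P.IsSolver sol)
    (i : Fin m) {S : Finset (Fin n)} (hS : S.Nonempty) : P.meanUse sol i S ≤ P.d i := by
  have : (0 : ℝ) < S.card := by exact_mod_cast hS.card_pos
  rw [meanUse, inv_mul_le_iff₀ this]
  exact (hsol S).1.2 i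

theorem abs_use_le {P : OnlineLP m n} {abar : ℝ} (ha : ∀ j i, |P.a j i| ≤ abar)
    {sol : Finset (Fin n) → Fin n → ℝ} (hsol : P.IsSolver sol) (i : Fin m)
    {S : Finset (Fin n)} {j : Fin n} (hj : j ∈ S) : |P.a j i * sol S j| ≤ abar := by
  obtain ⟨h0, h1⟩ := (hsol S).1.1 j hj
  rw [abs_mul, abs_of_nonneg h0]
  nlinarith [ha j i, abs_nonneg (P.a j i)]

theorem abs_meanUse_le {P : OnlineLP m n} {abar : ℝ} (ha : ∀ j i, |P.a j i| ≤ abar)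
    {sol : Finset (Fin n) → Fin n → ℝ} (hsol : P.IsSolver sol) (i : Fin m)
    {S : Finset (Fin n)} (hS : S.Nonempty) : |P.meanUse sol i S| ≤ abar := by
  have h : (0 : ℝ) < S.card := by exact_mod_cast hS.card_pos
  rw [meanUse, abs_mul, abs_of_pos (inv_pos.2 h), inv_mul_le_iff₀ h]
  refine (Finset.abs_sum_le_sum_abs _ _).trans
    ((Finset.sum_le_sum fun j hj => abs_use_le ha hsol i hj).trans ?_)
  simp

/-- Second moment of the consumption of resource `i` around its compensator, which is at most
`P.rhs i`. -/
theorem runExpect_use_sq_le {P : OnlineLP m n} {abar : ℝ} (ha : ∀ j i, |P.a j i| ≤ abar)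
    {sol : Finset (Fin n) → Fin n → ℝ} (hsol : P.IsSolver sol) (i : Fin m) :
    runExpect sol (fun σ x => (∑ t, P.a (σ t) i * bit (x t) -
      ∑ t, P.meanUse sol i (revealed σ t)) ^ 2) ≤ 5 * abar ^ 2 * n := by
  rw [runExpect_eq]
  refine (permAvg_mono fun σ => roundAvg_sum_sq_le (fraction_mem hsol σ)
    (fun t => P.a (σ t) i) (∑ t, P.meanUse sol i (revealed σ t)) abar
    (fun t => ha _ _)).trans ?_
  rw [permAvg_add, permAvg_const]
  -- Each time step contributes `abar ^ 2` from rounding and `(2 * abar) ^ 2` from the random order,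
  -- whence the factor `5`.
  have h := permAvg_sum_centered_sq_le
    (fun S j => P.a j i * sol S j - P.meanUse sol i S) ?_ (c := (2 * abar) ^ 2) ?_
  · simp only [Finset.sum_sub_distrib] at h
    exact (add_le_add_right h _).trans_eq (by ring)
  · intro S
    rcases S.eq_empty_or_nonempty with rfl | hS
    · simp
    · have h : (S.card : ℝ) ≠ 0 := by exact_mod_cast hS.card_pos.ne'
      rw [Finset.sum_sub_distrib, Finset.sum_const, nsmul_eq_mul, meanUse, mul_inv_cancel_left₀ h,
        sub_self]
  · intro S j hj
    have h1 := abs_le.1 (abs_use_le ha hsol i hj)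
    have h2 := abs_le.1 (abs_meanUse_le ha hsol i ⟨j, hj⟩)
    exact sq_le_sq' (by linarith) (by linarith)

theorem runExpect_violation_le {P : OnlineLP m n} {abar : ℝ} (habar : 0 ≤ abar)
    (ha : ∀ j i, |P.a j i| ≤ abar) {sol : Finset (Fin n) → Fin n → ℝ} (hsol : P.IsSolver sol) :
    runExpect sol P.violation ≤ 3 * abar * √(m * n) := by
  refine runExpect_le_of_sq_le hsol (by positivity) ?_
  -- The compensator lies below `P.rhs i`, so replacing the right-hand side by it can only enlarge a
  -- positive excess.
  have hpt : ∀ σ x, P.violation σ x ^ 2 ≤ ∑ i, (∑ t, P.a (σ t) i * bit (x t) -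
      ∑ t, P.meanUse sol i (revealed σ t)) ^ 2 := by
    intro σ x
    rw [violation, EuclideanSpace.norm_sq_eq]
    refine Finset.sum_le_sum fun i _ => ?_
    have hcomp : ∑ t, P.meanUse sol i (revealed σ t) ≤ P.rhs i := by
      have := Finset.sum_le_sum fun (t : Fin n) (_ : t ∈ Finset.univ) =>
        meanUse_le hsol i (S := revealed σ t) ⟨σ t, by simp [mem_revealed]⟩
      simpa [rhs] using this
    rw [Real.norm_eq_abs, sq_abs]
    change max _ _ ^ 2 ≤ _
    rcases le_total (∑ t, P.a (σ t) i * bit (x t) - P.rhs i) 0 with h | h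
    · rw [max_eq_right h, zero_pow two_ne_zero]
      positivity
    · rw [max_eq_left h]
      exact pow_le_pow_left₀ h (by linarith) 2
  refine (runExpect_mono hsol hpt).trans ?_
  have hsum : runExpect sol (fun σ x => ∑ i, (∑ t, P.a (σ t) i * bit (x t) -
      ∑ t, P.meanUse sol i (revealed σ t)) ^ 2) = ∑ i, runExpect sol (fun σ x =>
        (∑ t, P.a (σ t) i * bit (x t) - ∑ t, P.meanUse sol i (revealed σ t)) ^ 2) := by
    simp only [runExpect_eq, roundAvg_sum, permAvg_sum]
  rw [hsum]
  refine (Finset.sum_le_sum fun i _ => runExpect_use_sq_le ha hsol i).trans ?_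
  -- The constant `3` is a rounded-up `√5`.
  rw [mul_pow (3 * abar), Real.sq_sqrt (by positivity)]
  simp only [Finset.sum_const, Finset.card_univ, Fintype.card_fin, nsmul_eq_mul]
  have : 0 ≤ abar ^ 2 * (m * n) := by positivity
  linarith

/-! ### Loss in objective value -/

/-- Scaling a point that overloads each resource by at most `z` makes it feasible at a cost
proportional to `z`. -/
theorem sum_le_optimal_add {P : OnlineLP m n} {rbar dlow : ℝ} (hdlow : 0 < dlow)
    (hr : ∀ j, |P.r j| ≤ rbar) (hd : ∀ i, dlow ≤ P.d i) {S : Finset (Fin n)}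
    (hS : S.Nonempty) {y : Fin n → ℝ} (hy : P.IsScaledOptimal S y) {x : Fin n → ℝ}
    (hx : ∀ j, 0 ≤ x j ∧ x j ≤ 1) {z : ℝ} (hz : 0 ≤ z)
    (hxz : ∀ i, ∑ j ∈ S, P.a j i * x j ≤ S.card * P.d i + z) :
    ∑ j ∈ S, P.r j * x j ≤ ∑ j ∈ S, P.r j * y j + rbar / dlow * z := by
  have hk : (0 : ℝ) < S.card := by exact_mod_cast hS.card_pos
  -- `δ` is the overload relative to the smallest possible capacity `S.card * dlow`, so dividing `x`
  -- by `1 + δ` repairs all constraints at once.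
  obtain ⟨δ, hδ0, hzδ⟩ : ∃ δ : ℝ, 0 ≤ δ ∧ z = S.card * dlow * δ :=
    ⟨z / (S.card * dlow), by positivity, (mul_div_cancel₀ _ (mul_pos hk hdlow).ne').symm⟩
  have hpos : 0 < 1 + δ := by linarith
  have hopt := hy.2 (fun j => (1 + δ)⁻¹ * x j) ⟨fun j _ => ⟨
      mul_nonneg (inv_nonneg.2 hpos.le) (hx j).1, by
      rw [inv_mul_le_iff₀ hpos]
      linarith [(hx j).2]⟩, fun i => by
    have h1 : ∑ j ∈ S, P.a j i * ((1 + δ)⁻¹ * x j) = (1 + δ)⁻¹ * ∑ j ∈ S, P.a j i * x j := by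
      rw [Finset.mul_sum]
      exact Finset.sum_congr rfl fun j _ => by ring
    rw [h1, inv_mul_le_iff₀ hpos]
    refine (hxz i).trans ?_
    have h2 : S.card * dlow * δ ≤ S.card * P.d i * δ :=
      mul_le_mul_of_nonneg_right (mul_le_mul_of_nonneg_left (hd i) hk.le) hδ0
    rw [hzδ]
    linarith⟩
  have h1 : ∑ j ∈ S, P.r j * ((1 + δ)⁻¹ * x j) = (1 + δ)⁻¹ * ∑ j ∈ S, P.r j * x j := by
    rw [Finset.mul_sum]
    exact Finset.sum_congr rfl fun j _ => by ring
  rw [h1] at hopt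
  set V := ∑ j ∈ S, P.r j * x j with hV
  have hVle : |V| ≤ S.card * rbar := by
    rw [← nsmul_eq_mul, ← Finset.sum_const]
    refine (Finset.abs_sum_le_sum_abs _ _).trans (Finset.sum_le_sum fun j _ => ?_)
    rw [abs_mul, abs_of_nonneg (hx j).1]
    nlinarith [hr j, abs_nonneg (P.r j), (hx j).1, (hx j).2]
  have hloss : V - (1 + δ)⁻¹ * V ≤ δ * (S.card * rbar) := by
    have e : V - (1 + δ)⁻¹ * V = δ * ((1 + δ)⁻¹ * V) := by
      field_simp
      ring
    rw [e]
    refine mul_le_mul_of_nonneg_left ?_ hδ0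
    rw [inv_mul_le_iff₀ hpos]
    have h3 : 0 ≤ S.card * rbar := (abs_nonneg V).trans hVle
    nlinarith [(abs_le.1 hVle).2, mul_nonneg hδ0 h3]
  have hcost : δ * (S.card * rbar) = rbar / dlow * z := by
    rw [hzδ]
    field_simp
  linarith

/-- The full-LP point `x` is compared with the optimum on the revealed columns through
`sum_le_optimal_add`. The overload `z` is the Euclidean norm of the sampling fluctuations: it
dominates each coordinate, and its second moment is a sum over resources. -/
theorem permAvg_optimal_ge {P : OnlineLP m n} {rbar abar dlow : ℝ} (hdlow : 0 < dlow)
    (hrbar : 0 ≤ rbar) (habar : 0 ≤ abar)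
    (hr : ∀ j, |P.r j| ≤ rbar) (ha : ∀ j i, |P.a j i| ≤ abar) (hd : ∀ i, dlow ≤ P.d i)
    {sol : Finset (Fin n) → Fin n → ℝ} (hsol : P.IsSolver sol) {x : Fin n → ℝ}
    (hx : x ∈ P.primalFeasible) (t : Fin n) :
    ((t : ℝ) + 1) / n * ∑ j, P.r j * x j ≤
      permAvg (fun σ => ∑ j ∈ revealed σ t, P.r j * sol (revealed σ t) j) +
        rbar / dlow * (2 * abar * √(m * ((t : ℝ) + 1))) := by
  have hn : (0 : ℝ) < n := by exact_mod_cast t.pos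
  have ht : (0 : ℝ) < (t : ℝ) + 1 := by positivity
  set Z : Equiv.Perm (Fin n) → Fin m → ℝ := fun σ i =>
    ∑ j ∈ revealed σ t, P.a j i * x j - ((t : ℝ) + 1) / n * ∑ j, P.a j i * x j with hZ
  have hZle : permAvg (fun σ => √(∑ i, Z σ i ^ 2)) ≤ 2 * abar * √(m * ((t : ℝ) + 1)) := by
    refine permAvg_le_of_sq_le (by positivity) ?_
    have : ∀ σ, √(∑ i, Z σ i ^ 2) ^ 2 = ∑ i, Z σ i ^ 2 := fun σ =>
      Real.sq_sqrt (Finset.sum_nonneg fun i _ => sq_nonneg _)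
    simp only [this]
    rw [permAvg_sum]
    refine (Finset.sum_le_sum fun i _ => permAvg_prefix_sq_le (B := abar) (fun j => ?_) t).trans ?_
    · rw [abs_mul, abs_of_nonneg (hx.1 j).1]
      nlinarith [ha j i, abs_nonneg (P.a j i), (hx.1 j).1, (hx.1 j).2]
    · rw [mul_pow (2 * abar), Real.sq_sqrt (by positivity)]
      simp
      linarith
  have hpt : ∀ σ, ∑ j ∈ revealed σ t, P.r j * x j ≤
      ∑ j ∈ revealed σ t, P.r j * sol (revealed σ t) j + rbar / dlow * √(∑ i, Z σ i ^ 2) := by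
    intro σ
    refine sum_le_optimal_add hdlow hr hd ⟨σ t, by simp [mem_revealed]⟩ (hsol _) hx.1
      (Real.sqrt_nonneg _) fun i => ?_
    have h1 : Z σ i ≤ √(∑ i, Z σ i ^ 2) :=
      Real.le_sqrt_of_sq_le (Finset.single_le_sum (f := fun i => Z σ i ^ 2)
        (fun i _ => sq_nonneg _) (Finset.mem_univ i))
    have h2 : ((t : ℝ) + 1) / n * ∑ j, P.a j i * x j ≤ ((t : ℝ) + 1) * P.d i := by
      refine (mul_le_mul_of_nonneg_left (hx.2 i) (by positivity)).trans_eq ?_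
      rw [rhs]
      field_simp
    rw [card_revealed]
    have h3 : ∑ j ∈ revealed σ t, P.a j i * x j =
        Z σ i + ((t : ℝ) + 1) / n * ∑ j, P.a j i * x j := by
      simp [hZ]
    linarith
  have hmean : permAvg (fun σ => ∑ j ∈ revealed σ t, P.r j * x j) =
      ((t : ℝ) + 1) / n * ∑ j, P.r j * x j := by
    -- At the last time, index `n - 1`, every column is revealed; exchangeability there makes a
    -- single arrival uniform over all columns.
    have hlast : ∀ σ : Equiv.Perm (Fin n), revealed σ ⟨n - 1, by have := t.pos; omega⟩ =
        Finset.univ := by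
      intro σ
      ext j
      simp only [mem_revealed, Finset.mem_univ, iff_true, Fin.le_def]
      have := (σ.symm j).isLt
      omega
    simp only [sum_revealed, permAvg_sum]
    have heach : ∀ s : Fin n, permAvg (fun σ => P.r (σ s) * x (σ s)) =
        (n : ℝ)⁻¹ * ∑ j, P.r j * x j := by
      intro s
      set l : Fin n := ⟨n - 1, by have := t.pos; omega⟩ with hl
      have h1 := permAvg_revealed l (fun _ j => P.r j * x j)
      simp only [hlast, permAvg_const] at h1
      have h2 : ((l : ℕ) : ℝ) + 1 = n := by
        have : (l : ℕ) + 1 = n := by simp only [hl]; have := t.pos; omega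
        exact_mod_cast this
      rw [h2] at h1
      rw [← h1, ← permAvg_comp_mul_right (Equiv.swap s l) (fun σ => P.r (σ s) * x (σ s))]
      simp
    simp only [heach, Finset.sum_const, Fin.card_Iic, nsmul_eq_mul]
    push_cast
    ring
  rw [← hmean]
  refine (permAvg_mono hpt).trans ?_
  rw [permAvg_add, permAvg_const_mul]
  gcongr

/-- Telescoping: `1/√(k+1) ≤ 2(√(k+1) - √k)`. -/
theorem sum_inv_sqrt_le (n : ℕ) : ∑ t : Fin n, (√((t : ℝ) + 1))⁻¹ ≤ 2 * √n := by
  rw [Fin.sum_univ_eq_sum_range (fun t : ℕ => (√((t : ℝ) + 1))⁻¹)]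
  induction n with
  | zero => simp
  | succ k ih =>
    rw [Finset.sum_range_succ]
    have h0 := Real.sqrt_nonneg (k : ℝ)
    have h1 : 0 < √((k : ℝ) + 1) := Real.sqrt_pos.2 (by positivity)
    have h2 : √(k : ℝ) ^ 2 = k := Real.sq_sqrt (by positivity)
    have h3 : √((k : ℝ) + 1) ^ 2 = k + 1 := Real.sq_sqrt (by positivity)
    have h4 : (√((k : ℝ) + 1))⁻¹ ≤ 2 * (√((k : ℝ) + 1) - √k) := by
      rw [inv_le_iff_one_le_mul₀ h1]
      nlinarith [sq_nonneg (√((k : ℝ) + 1) - √k)]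
    push_cast
    linarith

theorem primalValue_sub_runExpect_reward_le {P : OnlineLP m n} {rbar abar dlow : ℝ}
    (hdlow : 0 < dlow) (hrbar : 0 ≤ rbar) (habar : 0 ≤ abar) (hn : 1 ≤ n)
    (hr : ∀ j, |P.r j| ≤ rbar) (ha : ∀ j i, |P.a j i| ≤ abar) (hd : ∀ i, dlow ≤ P.d i)
    {sol : Finset (Fin n) → Fin n → ℝ} (hsol : P.IsSolver sol) :
    P.primalValue - runExpect sol P.reward ≤ 4 * (rbar * abar / dlow) * √(m * n) := by
  have hn' : (0 : ℝ) < n := by exact_mod_cast hn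
  rw [sub_le_iff_le_add]
  -- The supremum is bounded point by point, so no optimal solution of the full LP is needed; `0` is
  -- feasible because `d` is positive.
  refine csSup_le ⟨_, 0, ⟨by simp, fun i => ?_⟩, rfl⟩ ?_
  · simpa [rhs] using mul_nonneg hn'.le (hdlow.le.trans (hd i))
  rintro _ ⟨x, hx, rfl⟩
  have hER : runExpect sol P.reward = ∑ t : Fin n, ((t : ℝ) + 1)⁻¹ *
      permAvg (fun σ => ∑ j ∈ revealed σ t, P.r j * sol (revealed σ t) j) := by
    rw [runExpect_eq]
    change permAvg (fun σ => roundAvg (fraction sol σ)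
      (fun x => ∑ t, P.r (σ t) * bit (x t))) = _
    simp only [roundAvg_sum, roundAvg_const_mul, roundAvg_bit, permAvg_sum, fraction]
    refine Finset.sum_congr rfl fun t _ => ?_
    rw [← permAvg_const_mul]
    exact permAvg_revealed t (fun S j => P.r j * sol S j)
  have hsum : ∑ t : Fin n, ((t : ℝ) + 1)⁻¹ * (((t : ℝ) + 1) / n * ∑ j, P.r j * x j) =
      ∑ j, P.r j * x j := by
    have : ∀ t : Fin n, ((t : ℝ) + 1)⁻¹ * (((t : ℝ) + 1) / n * ∑ j, P.r j * x j) =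
        (n : ℝ)⁻¹ * ∑ j, P.r j * x j := fun t => by
      have : (t : ℝ) + 1 ≠ 0 := by positivity
      field_simp
    simp only [this, Finset.sum_const, Finset.card_univ, Fintype.card_fin, nsmul_eq_mul]
    field_simp
  have hterm : ∀ t : Fin n, ((t : ℝ) + 1)⁻¹ * (((t : ℝ) + 1) / n * ∑ j, P.r j * x j) ≤
      ((t : ℝ) + 1)⁻¹ *
        permAvg (fun σ => ∑ j ∈ revealed σ t, P.r j * sol (revealed σ t) j) +
      2 * (rbar * abar / dlow) * √m * (√((t : ℝ) + 1))⁻¹ := by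
    intro t
    refine (mul_le_mul_of_nonneg_left (permAvg_optimal_ge hdlow hrbar habar hr ha hd hsol hx t)
      (by positivity)).trans_eq ?_
    rw [mul_add, Real.sqrt_mul (by positivity)]
    congr 1
    have h1 : √((t : ℝ) + 1) ≠ 0 := (Real.sqrt_pos.2 (by positivity)).ne'
    have h2 : ((t : ℝ) + 1)⁻¹ = (√((t : ℝ) + 1))⁻¹ * (√((t : ℝ) + 1))⁻¹ := by
      rw [← mul_inv, Real.mul_self_sqrt (by positivity)]
    rw [h2]
    field_simp
  change ∑ j, P.r j * x j ≤ _
  rw [← hsum, hER]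
  refine (Finset.sum_le_sum fun t _ => hterm t).trans ?_
  rw [Finset.sum_add_distrib, ← Finset.mul_sum, Real.sqrt_mul (by positivity)]
  have h := mul_le_mul_of_nonneg_left (sum_inv_sqrt_le n)
    (show 0 ≤ 2 * (rbar * abar / dlow) * √m by positivity)
  linarith

end Main

end

end OnlineLP

theorem theorem5 (rbar abar dlow dbar : ℝ) (hdlow : 0 < dlow) :
    ∃ C : ℝ, 0 < C ∧
      ∀ (m n : ℕ), 1 ≤ m → 1 ≤ n →
      ∀ P : OnlineLP m n, P.Bounded rbar abar dlow dbar → P.GeneralPosition →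
      ∀ sol : Finset (Fin n) → Fin n → ℝ, P.IsSolver sol →
        P.primalValue - OnlineLP.runExpect sol P.reward
            ≤ C * Real.sqrt ((m : ℝ) * n) ∧
        (2 ≤ n → OnlineLP.runExpect sol P.violation
            ≤ C * (Real.sqrt ((m : ℝ) * n) * Real.log n)) := by
  have hlog2 : 0 < Real.log 2 := Real.log_pos one_lt_two
  -- The `1` ensures positivity, the next two terms serve the two bounds, and `log 2 ≤ log n`
  -- absorbs the division by `log 2`. Absolute values are needed because `rbar` and `abar` are known
  -- to be nonnegative only once a column exists.
  refine ⟨1 + 4 * (|rbar| * |abar| / dlow) + 3 * |abar| / Real.log 2, by positivity, ?_⟩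
  intro m n hm hn P hP _ sol hsol
  have hrbar : 0 ≤ rbar := (abs_nonneg _).trans (hP.reward ⟨0, hn⟩)
  have habar : 0 ≤ abar := (abs_nonneg _).trans (hP.column ⟨0, hn⟩ ⟨0, hm⟩)
  rw [abs_of_nonneg hrbar, abs_of_nonneg habar]
  refine ⟨?_, fun hn2 => ?_⟩
  · refine (OnlineLP.primalValue_sub_runExpect_reward_le hdlow hrbar habar hn hP.reward hP.column
      hP.d_lower hsol).trans (mul_le_mul_of_nonneg_right ?_ (Real.sqrt_nonneg _))
    have : 0 ≤ 3 * abar / Real.log 2 := by positivity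
    linarith
  · refine (OnlineLP.runExpect_violation_le habar hP.column hsol).trans ?_
    have hlog : Real.log 2 ≤ Real.log n := Real.log_le_log two_pos (by exact_mod_cast hn2)
    have hlogn : 0 < Real.log n := hlog2.trans_le hlog
    have h1 : 3 * abar * √((m : ℝ) * n) ≤
        3 * abar / Real.log 2 * (√((m : ℝ) * n) * Real.log n) := by
      calc 3 * abar * √((m : ℝ) * n)
          = 3 * abar / Real.log 2 * (√((m : ℝ) * n) * Real.log 2) := by field_simp
        _ ≤ _ := by gcongr
    refine h1.trans (mul_le_mul_of_nonneg_right ?_ (by positivity))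
    have : 0 ≤ 4 * (rbar * abar / dlow) := by positivity
    linarith
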